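/- **Theorem.** Let $I$ be a non-empty finite set and let $X=(X_i)_{i\in I}$ be a random vector in $\mathbb R^I$ on a probability space. Call $X$ *max-stable* if for every $n\ge 1$ there are $a_n\in(0,\infty)^I$ and $b_n\in\mathbb R^I$ such that $a_nX+b_n$ has the same law as $\max(X^{(1)},\dots,X^{(n)})$, where $X^{(1)},\dots,X^{(n)}$ are independent copies of $X$ and all operations are componentwise. Call $X$ *simple max-stable* if it is max-stable and every margin is standard Fréchet, i.e. $\mathbb P(X_i\le x)=\exp(-1/x)$ for all $x\in(0,\infty)$ and $i\in I$. For $A\subset I$ write $X_A=(X_i)_{i\in A}$. 1. Suppose that $X$ is simple max-stable and that its law has a density with respect to Lebesgue measure that is positive and continuous on $(0,\infty)^I$ (and zero elsewhere). Then, for all disjoint non-empty subsets $A,B\subset I$: if $X_A$ and $X_B$ are conditionally independent given $X_{I\setminus(A\cup B)}$, then $X_A$ and $X_B$ are independent. 2. More generally, suppose that $X$ is max-stable and that there are (bounded or unbounded) open intervals $J_i\subset\mathbb R$, $i\in I$, such that the law of $X$ has a density with respect to Lebesgue measure that is positive and continuous on $\prod_{i\in I}J_i$ (and zero elsewhere).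 Then the same implication holds for all disjoint non-empty subsets $A,B\subset I$. -/

import Mathlib

open MeasureTheory ProbabilityTheory

namespace MaxStable

/-- The subvector `X_A = (X_i)_{i ∈ A}` of a random vector `X = (X_i)_{i ∈ I}`. -/
def subvector {I Ω : Type*} (X : Ω → I → ℝ) (A : Set I) : Ω → A → ℝ :=
  fun ω i => X ω i

/-- `X` is max-stable: for every `n ≥ 1` there are norming constants `a_i > 0` and `b_i` such that
`a X + b` has the same law as the componentwise maximum of `n` independent copies of `X`
(all operations are componentwise). The independent copies are realised on the `n`-fold
product of the underlying probability space, as `X` composed with the projections. -/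
def IsMaxStable {I Ω : Type*} [MeasurableSpace Ω] (P : Measure Ω) [IsProbabilityMeasure P]
    (X : Ω → I → ℝ) : Prop :=
  ∀ n : ℕ, 1 ≤ n → ∃ a b : I → ℝ, (∀ i, 0 < a i) ∧
    IdentDistrib (fun (ω : Ω) (i : I) => a i * X ω i + b i)
      (fun (w : Fin n → Ω) (i : I) => ⨆ k : Fin n, X (w k) i)
      P (Measure.pi fun _ : Fin n => P)

/-- `X` is simple max-stable: it is max-stable and its margins are standard Fréchet. -/
def IsSimpleMaxStable {I Ω : Type*} [MeasurableSpace Ω] (P : Measure Ω) [IsProbabilityMeasure P]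
    (X : Ω → I → ℝ) : Prop :=
  IsMaxStable P X ∧
    ∀ i : I, ∀ x : ℝ, 0 < x → P.real {ω | X ω i ≤ x} = Real.exp (-1 / x)

/-- The law of `X` is concentrated on `U` and has there a density with respect to Lebesgue measure
that is continuous and strictly positive on `U`. -/
def HasPosContDensityOn {I Ω : Type*} [Fintype I] [MeasurableSpace Ω] (P : Measure Ω)
    (X : Ω → I → ℝ) (U : Set (I → ℝ)) : Prop :=
  ∃ f : (I → ℝ) → ℝ, ContinuousOn f U ∧ (∀ x ∈ U, 0 < f x) ∧
    P.map X = (volume.restrict U).withDensity fun x => ENNReal.ofReal (f x)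

/-- `Y` and `Z` are conditionally independent given `W`, on an arbitrary probability space:
`P(Y ∈ s, Z ∈ t | W) = P(Y ∈ s | W) P(Z ∈ t | W)` almost surely, for all measurable `s`, `t`.
(On a standard Borel space this is Mathlib's `CondIndepFun`.) -/
def CondIndepGiven {Ω α β γ : Type*} [MeasurableSpace Ω] [MeasurableSpace α] [MeasurableSpace β]
    [mγ : MeasurableSpace γ] (P : Measure Ω) (Y : Ω → α) (Z : Ω → β) (W : Ω → γ) : Prop :=
  ∀ (s : Set α) (t : Set β), MeasurableSet s → MeasurableSet t →
    P⟦Y ⁻¹' s ∩ Z ⁻¹' t | mγ.comap W⟧ =ᵐ[P]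
      fun ω => (P⟦Y ⁻¹' s | mγ.comap W⟧) ω * (P⟦Z ⁻¹' t | mγ.comap W⟧) ω

end MaxStable

/-!
Max-stability means that, for every `n`, some componentwise increasing affine image of `X` has the
law of the maximum `M` of `n` independent copies of `X`. Conditional independence is not affected
by such transformations, so every consequence of it for `X` holds for `M` too, and the exponential
rates as `n → ∞` can be compared. Write `C` for the complement of `A ∪ B`, `F` for the
distribution function of `X` and `F_E` for the distribution function of `X_E`, and fix levels `x`
for the coordinates in `A ∪ B` and `y` for those in `C`.

The conditional probabilities given `M_C` satisfy
`P(M_A ≤ x, M_B ≤ x | M_C) = P(M_A ≤ x | M_C) P(M_B ≤ x | M_C)`. If the left hand side is at most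
`c` where `M_C > y`, the Cauchy–Schwarz inequality gives (`measureReal_inter_inter_le_sqrt`)

  `P(M_A ≤ x, M_B ≤ x, M_C > y) ≤ √(c P(M_A ≤ x) P(M_B ≤ x)) = √(c F_A(x) ^ n F_B(x) ^ n)`.

The left hand side is `F_{A ∪ B}(x) ^ n` up to exponentially smaller terms: this uses that `F` is
strictly increasing in the coordinates in `C` at the levels concerned, which follows from the
positivity of the density. An exchange argument bounds `c`. Only `|C|` of the copies are needed to
attain the maximum in the coordinates in `C`; each of the others may be replaced by a copy that
violates `X_{A ∪ B} ≤ x` but is below `y` in the coordinates in `C`, and this does not change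
`M_C`. Thus `c` may be taken as `(q / (q + p)) ^ n` up to polynomial factors, where
`q = F_{A ∪ B}(x)`, `p` is the probability that a copy is of the latter kind, and `q + p ≥ F_C(y)`
(`measure_forall_mem_and_iSup_mem_le`). Comparison of the rates yields
`F_{A ∪ B}(x) F_C(y) ≤ F_A(x) F_B(x)` (`measureReal_lowerEvent_union_mul_le`), and when `y` tends
to the upper end of the support, `F_{A ∪ B} ≤ F_A F_B`.

The reverse inequality is the positive dependence of max-infinitely divisible laws
(`IsMaxStable.mul_le_measureReal_lowerEvent_union`). So the distribution function of `X_{A ∪ B}`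
factorizes. The first part of the theorem is the special case of the second in which all intervals
are `(0, ∞)`.
-/

namespace MaxStable

/-! ### Exchange of copies that do not affect the maximum -/

section Exchange

variable {Ω κ ι : Type*} [MeasurableSpace Ω] [Fintype κ] [Fintype ι]

/-- The exchange step with the positions `j i` of the maxima in the coordinates `i` prescribed.
On the left all copies lie in `G`; on the right a copy away from the prescribed positions may also
lie in `L`, where it is too small to affect the maximum. -/
theorem measure_argmax_le (P : Measure Ω) [IsProbabilityMeasure P] {Z : Ω → κ → ℝ}
    (hZ : Measurable Z) {G L : Set Ω} (hG : MeasurableSet G) (hL : MeasurableSet L)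
    (hGL : Disjoint G L) {S : Set (κ → ℝ)} (hS : MeasurableSet S) {s : ENNReal} (hs1 : s ≤ 1)
    (hs : ∀ r ≤ P G, r ≤ s * (r + P L)) (j : κ → ι) :
    Measure.pi (fun _ : ι => P) {w | (∀ k, w k ∈ G) ∧ (∀ k i, Z (w k) i ≤ Z (w (j i)) i) ∧
        (fun i => Z (w (j i)) i) ∈ S} ≤
      s ^ (Fintype.card ι - Fintype.card κ) * Measure.pi (fun _ : ι => P)
        {w | (fun i => Z (w (j i)) i) ∈ S ∧ ∀ k, w k ∈ L ∨ ∀ i, Z (w k) i ≤ Z (w (j i)) i} := by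
  classical
  have hZi : ∀ i, Measurable fun ω => Z ω i := fun i => (measurable_pi_apply i).comp hZ
  obtain ⟨p, hp⟩ : ∃ p : ι → Prop, ∀ k, p k ↔ k ∈ Set.range j := ⟨_, fun _ => Iff.rfl⟩
  let j' : κ → {k // p k} := fun i => ⟨j i, (hp _).2 ⟨i, rfl⟩⟩
  have mp := measurePreserving_piEquivPiSubtypeProd (fun _ : ι => P) p
  set e := MeasurableEquiv.piEquivPiSubtypeProd (fun _ : ι => Ω) p
  let U : Set ({k // p k} → Ω) := {u | (∀ k, u k ∈ G) ∧ (∀ k i, Z (u k) i ≤ Z (u (j' i)) i) ∧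
    (fun i => Z (u (j' i)) i) ∈ S}
  -- given the copies at the prescribed positions, the others are independently restricted to `R`
  let R : ({k // p k} → Ω) → Set Ω := fun u => {ω | ω ∈ G ∧ ∀ i, Z ω i ≤ Z (u (j' i)) i}
  let D : Set (({k // p k} → Ω) × ({k // ¬ p k} → Ω)) := {z | z.1 ∈ U ∧ ∀ k, z.2 k ∈ R z.1}
  let D' : Set (({k // p k} → Ω) × ({k // ¬ p k} → Ω)) :=
    {z | z.1 ∈ U ∧ ∀ k, z.2 k ∈ R z.1 ∪ L}
  have hU : MeasurableSet U := by
    have h1 : MeasurableSet {u : {k // p k} → Ω | ∀ k, u k ∈ G} := by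
      simp only [Set.ofPred_forall]
      exact MeasurableSet.iInter fun k => measurable_pi_apply k hG
    have h2 : MeasurableSet {u : {k // p k} → Ω | ∀ k i, Z (u k) i ≤ Z (u (j' i)) i} := by
      simp only [Set.ofPred_forall]
      exact MeasurableSet.iInter fun k => MeasurableSet.iInter fun i =>
        measurableSet_le ((hZi i).comp (measurable_pi_apply k))
          ((hZi i).comp (measurable_pi_apply (j' i)))
    have h3 : MeasurableSet {u : {k // p k} → Ω | (fun i => Z (u (j' i)) i) ∈ S} :=
      (measurable_pi_lambda _ fun i => (hZi i).comp (measurable_pi_apply (j' i))) hS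
    exact h1.inter (h2.inter h3)
  have hR : ∀ k : {k // ¬ p k},
      MeasurableSet {z : ({k // p k} → Ω) × ({k // ¬ p k} → Ω) | z.2 k ∈ R z.1} := by
    intro k
    have hk : Measurable fun z : ({k // p k} → Ω) × ({k // ¬ p k} → Ω) => z.2 k :=
      (measurable_pi_apply k).comp measurable_snd
    have : {z : ({k // p k} → Ω) × ({k // ¬ p k} → Ω) | z.2 k ∈ R z.1} =
        (fun z => z.2 k) ⁻¹' G ∩ ⋂ i, {z | Z (z.2 k) i ≤ Z (z.1 (j' i)) i} := by
      ext z; simp [R]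
    rw [this]
    refine (hk hG).inter ?_
    exact MeasurableSet.iInter fun i => measurableSet_le ((hZi i).comp hk)
      ((hZi i).comp ((measurable_pi_apply (j' i)).comp measurable_fst))
  have hD : MeasurableSet D := by
    have : D = Prod.fst ⁻¹' U ∩
        ⋂ k, {z : ({k // p k} → Ω) × ({k // ¬ p k} → Ω) | z.2 k ∈ R z.1} := by
      ext z; simp [D]
    rw [this]
    exact (measurable_fst hU).inter (MeasurableSet.iInter hR)
  have hD' : MeasurableSet D' := by
    have : D' = Prod.fst ⁻¹' U ∩ ⋂ k, ({z : ({k // p k} → Ω) × ({k // ¬ p k} → Ω) | z.2 k ∈ R z.1} ∪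
        {z | z.2 k ∈ L}) := by
      ext z; simp [D']
    rw [this]
    refine (measurable_fst hU).inter (MeasurableSet.iInter fun k => (hR k).union ?_)
    exact ((measurable_pi_apply k).comp measurable_snd) hL
  have hcard : Fintype.card ι - Fintype.card κ ≤ Fintype.card {k // ¬ p k} := by
    have h1 := Fintype.card_subtype_compl p
    have h2 : Fintype.card {k // p k} ≤ Fintype.card κ := by
      refine Fintype.card_le_of_surjective j' ?_
      rintro ⟨k, hk⟩
      obtain ⟨i, rfl⟩ := (hp k).1 hk
      exact ⟨i, rfl⟩
    omega
  have key : ((Measure.pi fun _ : {k // p k} => P).prod (Measure.pi fun _ : {k // ¬ p k} => P)) D ≤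
      s ^ (Fintype.card ι - Fintype.card κ) *
      ((Measure.pi fun _ : {k // p k} => P).prod (Measure.pi fun _ : {k // ¬ p k} => P)) D' := by
    rw [Measure.prod_apply hD, Measure.prod_apply hD', ← lintegral_const_mul' _ _
      (ENNReal.pow_ne_top (ne_top_of_le_ne_top ENNReal.one_ne_top hs1))]
    refine lintegral_mono fun u => ?_
    by_cases hu : u ∈ U
    · have e1 : Prod.mk u ⁻¹' D = Set.univ.pi fun _ => R u := by
        ext v; simp [D, hu]
      have e2 : Prod.mk u ⁻¹' D' = Set.univ.pi fun _ => R u ∪ L := by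
        ext v; simp [D', hu]
      have hd : Disjoint (R u) L := hGL.mono_left fun ω h => h.1
      simp only [e1, e2, Measure.pi_pi, Finset.prod_const, Finset.card_univ,
        measure_union hd hL]
      calc P (R u) ^ Fintype.card {k // ¬ p k}
          ≤ (s * (P (R u) + P L)) ^ Fintype.card {k // ¬ p k} := by
            gcongr
            exact hs _ (measure_mono fun ω h => h.1)
        _ ≤ _ := by
            rw [mul_pow]
            gcongr ?_ * _
            exact pow_le_pow_right_of_le_one' hs1 hcard
    · have e1 : Prod.mk u ⁻¹' D = ∅ := by
        ext v; simp [D, hu]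
      simp [e1]
  refine le_trans (le_of_eq ?_) (key.trans ?_)
  · rw [← mp.measure_preimage hD.nullMeasurableSet]
    congr 1
    ext w
    have hew : e w = (fun k : {k // p k} => w k, fun k : {k // ¬ p k} => w k) := rfl
    simp only [Set.mem_preimage, hew, D, U, R, Set.mem_ofPred_eq, j']
    constructor
    · rintro ⟨h1, h2, h3⟩
      exact ⟨⟨fun k => h1 k, fun k => h2 k, h3⟩, fun k => ⟨h1 k, h2 k⟩⟩
    · rintro ⟨⟨h1, h2, h3⟩, h4⟩
      refine ⟨fun k => ?_, fun k => ?_, h3⟩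
      · by_cases hk : p k
        exacts [h1 ⟨k, hk⟩, (h4 ⟨k, hk⟩).1]
      · by_cases hk : p k
        exacts [h2 ⟨k, hk⟩, (h4 ⟨k, hk⟩).2]
  · gcongr
    rw [← mp.measure_preimage hD'.nullMeasurableSet]
    refine measure_mono fun w hw => ?_
    obtain ⟨⟨-, h2, h3⟩, h4⟩ := hw
    refine ⟨h3, fun k => ?_⟩
    by_cases hk : p k
    · exact Or.inr (h2 ⟨k, hk⟩)
    · rcases h4 ⟨k, hk⟩ with h | h
      exacts [Or.inr h.2, Or.inl h]

/-- Among independent copies of a random vector, replacing typical copies that lie in `G` by copies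
that lie in `L`, outside `G` but below `y₀`, does not change a maximum in `S ⊆ [y₀, ∞)`. Hence, up
to a factor of polynomial growth in the number `n` of copies, the event that all copies lie in `G`
has conditional probability at most `s ^ n` given that the maximum is in `S`, for
`s = P G / (P G + P L)`. -/
theorem measure_forall_mem_and_iSup_mem_le [Nonempty ι] (P : Measure Ω) [IsProbabilityMeasure P]
    {Z : Ω → κ → ℝ} (hZ : Measurable Z) {G L : Set Ω} (hG : MeasurableSet G)
    (hL : MeasurableSet L) (hGL : Disjoint G L) {y₀ : κ → ℝ} (hLy : ∀ ω ∈ L, Z ω ≤ y₀)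
    {S : Set (κ → ℝ)} (hS : MeasurableSet S) (hSy : ∀ y ∈ S, y₀ ≤ y) {s : ENNReal} (hs1 : s ≤ 1)
    (hs : ∀ r ≤ P G, r ≤ s * (r + P L)) :
    Measure.pi (fun _ : ι => P) {w | (∀ k, w k ∈ G) ∧ (fun i => ⨆ k, Z (w k) i) ∈ S} ≤
      (Fintype.card ι : ENNReal) ^ Fintype.card κ *
        (s ^ (Fintype.card ι - Fintype.card κ) *
          Measure.pi (fun _ : ι => P) {w | (fun i => ⨆ k, Z (w k) i) ∈ S}) := by
  classical
  have hbdd : ∀ (w : ι → Ω) i, BddAbove (Set.range fun k => Z (w k) i) :=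
    fun w i => (Set.finite_range _).bddAbove
  have hmax : ∀ (w : ι → Ω) (j : κ → ι), (∀ k i, Z (w k) i ≤ Z (w (j i)) i) →
      (fun i => ⨆ k, Z (w k) i) = fun i => Z (w (j i)) i := fun w j h => funext fun i =>
    le_antisymm (ciSup_le fun k => h k i) (le_ciSup (hbdd w i) (j i))
  calc _ ≤ Measure.pi (fun _ : ι => P) (⋃ j : κ → ι, {w | (∀ k, w k ∈ G) ∧
        (∀ k i, Z (w k) i ≤ Z (w (j i)) i) ∧ (fun i => Z (w (j i)) i) ∈ S}) := by
        refine measure_mono fun w ⟨h1, h2⟩ => ?_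
        choose j hj using fun i => Finite.exists_max fun k => Z (w k) i
        have hj' : ∀ k i, Z (w k) i ≤ Z (w (j i)) i := fun k i => hj i k
        exact Set.mem_iUnion.2 ⟨j, h1, hj', hmax w j hj' ▸ h2⟩
    _ ≤ ∑ j : κ → ι, _ := measure_iUnion_fintype_le _ _
    _ ≤ ∑ j : κ → ι, (s ^ (Fintype.card ι - Fintype.card κ) *
          Measure.pi (fun _ : ι => P) {w | (fun i => ⨆ k, Z (w k) i) ∈ S}) := by
        refine Finset.sum_le_sum fun j _ => (measure_argmax_le P hZ hG hL hGL hS hs1 hs j).trans ?_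
        gcongr with w
        rintro ⟨h1, h2⟩
        have h3 : ∀ k i, Z (w k) i ≤ Z (w (j i)) i := by
          intro k
          rcases h2 k with h | h
          · exact fun i => (hLy _ h i).trans (hSy _ h1 i)
          · exact h
        rw [hmax w j h3]
        exact h1
    _ = _ := by simp

end Exchange

/-! ### Cauchy–Schwarz under conditional independence -/

/-- If two events are conditionally independent given `m` and their conditional probability of
occurring jointly is at most `c` on `T`, then the Cauchy–Schwarz inequality bounds the probability
of the two events and `T` by `√(c α β)`, where `α` and `β` bound the individual probabilities. -/
theorem measureReal_inter_inter_le_sqrt {Ω : Type*} {m mΩ : MeasurableSpace Ω} (hm : m ≤ mΩ)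
    (P : Measure Ω) [IsProbabilityMeasure P] {G H T : Set Ω} (hG : MeasurableSet G)
    (hH : MeasurableSet H) (hT : MeasurableSet[m] T)
    (hci : P⟦G ∩ H | m⟧ =ᵐ[P] fun ω => (P⟦G | m⟧) ω * (P⟦H | m⟧) ω) {c α β : ℝ} (hc : 0 ≤ c)
    (hα : 0 < α) (hβ : 0 < β) (hGα : P.real G ≤ α) (hHβ : P.real H ≤ β)
    (hle : ∀ T' ⊆ T, MeasurableSet[m] T' → P.real (G ∩ H ∩ T') ≤ c * P.real T') :
    P.real (G ∩ H ∩ T) ≤ √(c * α * β) := by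
  have hGH := hG.inter hH
  have hint : ∀ s : Set Ω, MeasurableSet s → Integrable (s.indicator fun _ => (1 : ℝ)) P :=
    fun s hs => (integrable_const 1).indicator hs
  set u := P⟦G ∩ H | m⟧
  set v := P⟦G | m⟧
  set w := P⟦H | m⟧
  have hset : ∀ s t : Set Ω, MeasurableSet s → MeasurableSet[m] t →
      ∫ ω in t, (P⟦s | m⟧) ω ∂P = P.real (s ∩ t) := by
    intro s t hs ht
    rw [setIntegral_condExp hm (hint s hs) ht, integral_indicator_const _ hs,
      measureReal_restrict_apply hs]
    simp
  have hnn : ∀ s : Set Ω, 0 ≤ᵐ[P] P⟦s | m⟧ := fun s =>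
    condExp_nonneg (Filter.Eventually.of_forall fun ω => Set.indicator_nonneg (by simp) ω)
  have hu : ∀ᵐ ω ∂P, ω ∈ T → u ω ≤ c := by
    have hmeas : MeasurableSet[m] (T ∩ {ω | c < u ω}) :=
      hT.inter (measurableSet_lt measurable_const stronglyMeasurable_condExp.measurable)
    have h0 := hset _ _ hGH hmeas
    have h1 := hle _ Set.inter_subset_left hmeas
    have h2 : ∫ ω in T ∩ {ω | c < u ω}, (u ω - c) ∂P ≤ 0 := by
      rw [integral_sub integrable_condExp.integrableOn (integrable_const c), h0]
      simp only [integral_const, measureReal_restrict_apply_univ, smul_eq_mul]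
      linarith
    have h3 : P (T ∩ {ω | c < u ω}) = 0 := by
      by_contra hne
      refine absurd h2 (not_le.2 ?_)
      rw [setIntegral_pos_iff_support_of_nonneg_ae]
      · refine lt_of_lt_of_le (pos_iff_ne_zero.2 hne) (measure_mono fun ω hω => ⟨?_, hω⟩)
        exact (sub_pos.2 hω.2).ne'
      · filter_upwards [ae_restrict_mem (hm _ hmeas)] with ω hω
        exact (sub_pos.2 hω.2).le
      · exact (integrable_condExp.sub (integrable_const c)).integrableOn
    filter_upwards [measure_eq_zero_iff_ae_notMem.1 h3] with ω hω hωT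
    exact not_lt.1 fun h => hω ⟨hωT, h⟩
  -- weights for which the inequality of arithmetic and geometric means below is sharp when the
  -- conditional probabilities are `α` and `β`
  set a := √(c * β / α) / 2
  set b := √(c * α / β) / 2
  have ha : 0 ≤ a := by positivity
  have hb : 0 ≤ b := by positivity
  have hab : 4 * (a * b) = c := by
    have : √(c * β / α) * √(c * α / β) = c := by
      rw [← Real.sqrt_mul (by positivity)]
      rw [show c * β / α * (c * α / β) = c ^ 2 by field_simp, Real.sqrt_sq hc]
    simp only [a, b]; linarith
  have hle1 : ∀ᵐ ω ∂P, ω ∈ T → u ω ≤ a * v ω + b * w ω := by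
    filter_upwards [hu, hci, hnn G, hnn H, hnn (G ∩ H)] with ω h1 h2 h3 h4 h5 hωT
    have h1 := h1 hωT
    change u ω = v ω * w ω at h2
    change 0 ≤ v ω at h3
    change 0 ≤ w ω at h4
    change 0 ≤ u ω at h5
    -- `u² ≤ c u = 4 a b v w ≤ (a v + b w)²`
    refine abs_le_of_sq_le_sq' ?_ (by positivity) |>.2
    nlinarith [sq_nonneg (a * v ω - b * w ω), mul_le_mul_of_nonneg_left h1 h5]
  have ea : a * α = √(c * α * β) / 2 := by
    simp only [a]
    rw [show c * α * β = (c * β / α) * α ^ 2 by field_simp, Real.sqrt_mul (by positivity),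
      Real.sqrt_sq hα.le]
    ring
  have eb : b * β = √(c * α * β) / 2 := by
    simp only [b]
    rw [show c * α * β = (c * α / β) * β ^ 2 by field_simp, Real.sqrt_mul (by positivity),
      Real.sqrt_sq hβ.le]
    ring
  have hi : ∀ s : Set Ω, IntegrableOn (P⟦s | m⟧) T P := fun s => integrable_condExp.integrableOn
  calc P.real (G ∩ H ∩ T) = ∫ ω in T, u ω ∂P := (hset _ _ hGH hT).symm
    _ ≤ ∫ ω in T, (a * v ω + b * w ω) ∂P :=
        setIntegral_mono_on_ae (hi _) (((hi G).const_mul a).add ((hi H).const_mul b)) (hm _ hT) hle1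
    _ = a * P.real (G ∩ T) + b * P.real (H ∩ T) := by
        rw [integral_add ((hi G).const_mul a) ((hi H).const_mul b), integral_const_mul,
          integral_const_mul, hset _ _ hG hT, hset _ _ hH hT]
    _ ≤ a * α + b * β := by
        gcongr
        · exact (measureReal_mono Set.inter_subset_left).trans hGα
        · exact (measureReal_mono Set.inter_subset_left).trans hHβ
    _ = √(c * α * β) := by rw [ea, eb]; ring

/-! ### Exponential rates of maxima -/

open Filter Topology in
/-- If `q ^ n`, up to exponentially smaller terms, is at most `√(s γ) ^ n` up to a factor of
polynomial growth, then `q ^ 2 ≤ s γ`. -/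
theorem sq_le_mul_of_forall_pow_sub_sum_le {κ : Type*} [Fintype κ] {q s γ : ℝ} (hq : 0 < q)
    (hs : 0 < s) (hγ : 0 < γ) {p : κ → ℝ} (hp : ∀ i, 0 ≤ p i) (hpq : ∀ i, p i < q) (d : ℕ)
    (h : ∀ n : ℕ, 1 ≤ n → q ^ n - ∑ i, p i ^ n ≤ √((n : ℝ) ^ d * s ^ (n - d) * γ ^ n)) :
    q ^ 2 ≤ s * γ := by
  by_contra! hlt
  have h1 : Tendsto (fun n : ℕ => ∑ i, (p i / q) ^ n) atTop (𝓝 0) := by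
    rw [← Finset.sum_const_zero (s := (Finset.univ : Finset κ))]
    exact tendsto_finsetSum _ fun i _ => tendsto_pow_atTop_nhds_zero_of_lt_one
      (div_nonneg (hp i) hq.le) ((div_lt_one hq).2 (hpq i))
  have hr : 1 < q ^ 2 / (s * γ) := (one_lt_div (by positivity)).2 hlt
  have h2 := tendsto_pow_const_div_const_pow_of_one_lt d hr
  obtain ⟨n, hn1, hn2, hn3⟩ := ((h1.eventually_le_const (u := 1 / 2) (by norm_num)).and
    ((h2.eventually_lt_const (u := s ^ d / 4) (by positivity)).and
      (eventually_ge_atTop (d + 1)))).exists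
  have hsum : ∑ i, p i ^ n ≤ q ^ n / 2 := by
    have : ∑ i, p i ^ n = (∑ i, (p i / q) ^ n) * q ^ n := by
      rw [Finset.sum_mul]
      refine Finset.sum_congr rfl fun i _ => ?_
      rw [div_pow, div_mul_cancel₀ _ (by positivity)]
    rw [this]
    have := mul_le_mul_of_nonneg_right hn1 (pow_nonneg hq.le n)
    linarith
  have h3 : q ^ n / 2 ≤ √((n : ℝ) ^ d * s ^ (n - d) * γ ^ n) := by
    linarith [h n (by omega)]
  have h4 : (q ^ n / 2) ^ 2 ≤ (n : ℝ) ^ d * s ^ (n - d) * γ ^ n :=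
    (Real.le_sqrt' (by positivity)).1 h3
  rw [div_lt_iff₀ (by positivity), div_pow, mul_pow] at hn2
  have h5 : s ^ n = s ^ (n - d) * s ^ d := by rw [← pow_add]; congr 1; omega
  rw [h5] at hn2
  have h6 : s ^ d / 4 * ((q ^ 2) ^ n / (s ^ (n - d) * s ^ d * γ ^ n)) =
      (q ^ n / 2) ^ 2 / (s ^ (n - d) * γ ^ n) := by
    field_simp
    ring
  rw [h6, lt_div_iff₀ (by positivity)] at hn2
  nlinarith

/-- The event that `X` is below `x` in all coordinates in `A`, so that `x ↦ P (lowerEvent X A x)` is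
the distribution function of `X_A`. -/
def lowerEvent {I Ω : Type*} (X : Ω → I → ℝ) (A : Set I) (x : I → ℝ) : Set Ω :=
  {ω | ∀ i ∈ A, X ω i ≤ x i}

section

variable {I Ω : Type*}

theorem measurableSet_lowerEvent [Countable I] [MeasurableSpace Ω] {X : Ω → I → ℝ}
    (hX : Measurable X) (A : Set I) (x : I → ℝ) :
    MeasurableSet (lowerEvent X A x) := by
  have : lowerEvent X A x = ⋂ i ∈ A, {ω | X ω i ≤ x i} := by ext; simp [lowerEvent]
  rw [this]
  exact MeasurableSet.biInter (Set.to_countable A) fun i _ =>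
    measurableSet_le ((measurable_pi_apply i).comp hX) measurable_const

theorem lowerEvent_union (X : Ω → I → ℝ) (A B : Set I) (x : I → ℝ) :
    lowerEvent X (A ∪ B) x = lowerEvent X A x ∩ lowerEvent X B x := by
  ext; simp [lowerEvent, or_imp, forall_and]

theorem iSup_le_iff_forall_mem_lowerEvent {n : ℕ} (hn : 1 ≤ n) (X : Ω → I → ℝ) (A : Set I)
    (x : I → ℝ) (w : Fin n → Ω) :
    (∀ i ∈ A, (⨆ k : Fin n, X (w k) i) ≤ x i) ↔ ∀ k, w k ∈ lowerEvent X A x := by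
  have : Nonempty (Fin n) := ⟨⟨0, hn⟩⟩
  simp only [lowerEvent, Set.mem_ofPred_eq]
  rw [forall_comm]
  refine forall_congr' fun i => ?_
  rw [forall_comm]
  exact forall_congr' fun _ => ciSup_le_iff (Set.finite_range _).bddAbove

variable [Fintype I] [MeasurableSpace Ω] {X : Ω → I → ℝ}

theorem pi_setOf_forall_mem {n : ℕ} (P : Measure Ω) [IsProbabilityMeasure P] (G : Set Ω) :
    (Measure.pi fun _ : Fin n => P).real {w | ∀ k, w k ∈ G} = P.real G ^ n := by
  have : {w : Fin n → Ω | ∀ k, w k ∈ G} = Set.univ.pi fun _ => G := by ext; simp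
  simp [this, measureReal_def, Measure.pi_pi]

/-- The consequence of conditional independence for the law of the `n`-fold maximum `M`. The left
hand side is a lower bound for `P (M_A ≤ x, M_B ≤ x, M_C > y)`, and the right hand side comes from
the exchange argument and the Cauchy–Schwarz inequality. -/
theorem pow_sub_sum_pow_le_sqrt {P : Measure Ω} [IsProbabilityMeasure P] (hX : Measurable X)
    (hms : IsMaxStable P X) {A B C : Set I}
    (hci : CondIndepGiven P (subvector X A) (subvector X B) (subvector X C))
    {x y : I → ℝ} {q p : ℝ} (hq : P.real (lowerEvent X (A ∪ B) x) = q) (hq0 : 0 < q)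
    (hp : P.real ((lowerEvent X (A ∪ B) x)ᶜ ∩ lowerEvent X C y) = p)
    [Fintype C] {n : ℕ} (hn : 1 ≤ n) :
    q ^ n - ∑ i : C,
        P.real (lowerEvent X (A ∪ B) x ∩ {ω | X ω i ≤ y i}) ^ n ≤
      √((n : ℝ) ^ Fintype.card C *
        (q / (q + p)) ^ (n - Fintype.card C) *
        (P.real (lowerEvent X A x) * P.real (lowerEvent X B x)) ^ n) := by
  have : Nonempty (Fin n) := ⟨⟨0, hn⟩⟩
  obtain ⟨a, b, ha, hid⟩ := hms n hn
  have hXi : ∀ i, Measurable fun ω => X ω i := fun i => (measurable_pi_apply i).comp hX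
  have hp0 : 0 ≤ p := hp ▸ measureReal_nonneg
  have hidr : ∀ D : Set (I → ℝ), MeasurableSet D →
      P.real {ω | (fun i => a i * X ω i + b i) ∈ D} =
      (Measure.pi fun _ : Fin n => P).real {w | (fun i => ⨆ k, X (w k) i) ∈ D} := fun D hD =>
    congrArg ENNReal.toReal (hid.measure_mem_eq hD)
  have hmD : ∀ E : Set I, MeasurableSet {v : I → ℝ | ∀ i ∈ E, v i ≤ x i} := fun E =>
    measurableSet_lowerEvent (X := id) measurable_id E x
  let GA : Set I → Set Ω := fun E => {ω | ∀ i ∈ E, a i * X ω i + b i ≤ x i}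
  have hGA : ∀ E, P.real (GA E) = P.real (lowerEvent X E x) ^ n := by
    intro E
    rw [← pi_setOf_forall_mem]
    refine (hidr _ (hmD E)).trans (congrArg _ ?_)
    ext w
    exact iSup_le_iff_forall_mem_lowerEvent hn X E x w
  have hGAm : ∀ E, MeasurableSet (GA E) := fun E =>
    measurableSet_lowerEvent (X := fun ω i => a i * X ω i + b i)
      (measurable_pi_lambda _ fun i => ((hXi i).const_mul _).add_const _) E x
  have hGAU : GA A ∩ GA B = GA (A ∪ B) := (lowerEvent_union _ A B x).symm
  -- the event that the maximum exceeds `y` in the conditioning coordinates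
  let S : Set (C → ℝ) := {v | ∀ i : C, y i < v i}
  have hS : MeasurableSet S := by
    have : S = ⋂ i : C, {v | y i < v i} := by ext; simp [S]
    rw [this]
    exact MeasurableSet.iInter fun i => measurableSet_lt measurable_const (measurable_pi_apply i)
  let T : Set Ω := {ω | (fun i : C => a i * X ω i + b i) ∈ S}
  have hW : Measurable (subvector X C) := measurable_pi_lambda _ fun i => hXi i
  have hm := hW.comap_le
  have haff : Measurable fun (v : C → ℝ) (i : C) => a i * v i + b i :=
    measurable_pi_lambda _ fun i => ((measurable_pi_apply i).const_mul _).add_const _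
  have hT : MeasurableSet[MeasurableSpace.comap (subvector X C) inferInstance] T :=
    ⟨_, haff hS, rfl⟩
  have hcond : P⟦GA A ∩ GA B | MeasurableSpace.comap (subvector X C) inferInstance⟧ =ᵐ[P]
      fun ω => (P⟦GA A | MeasurableSpace.comap (subvector X C) inferInstance⟧) ω *
        (P⟦GA B | MeasurableSpace.comap (subvector X C) inferInstance⟧) ω := by
    have hpre : ∀ E : Set I, ∃ s : Set (E → ℝ), MeasurableSet s ∧ GA E = subvector X E ⁻¹' s := by
      intro E
      refine ⟨{v | ∀ i ∈ (Set.univ : Set E), a i * v i + b i ≤ x i},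
        measurableSet_lowerEvent (I := E) (X := fun (v : E → ℝ) i => a i * v i + b i)
          (measurable_pi_lambda _ fun i => ((measurable_pi_apply i).const_mul _).add_const _) _
          (fun i => x i), ?_⟩
      ext ω
      simp [GA, subvector]
    obtain ⟨s, hs, es⟩ := hpre A
    obtain ⟨t, ht, et⟩ := hpre B
    rw [es, et]
    exact hci s t hs ht
  set c : ℝ := (n : ℝ) ^ Fintype.card C * (q / (q + p)) ^ (n - Fintype.card C)
  have hmax : ∀ S' : Set (C → ℝ), MeasurableSet S' →
      P.real (GA (A ∪ B) ∩ {ω | (fun i : C => a i * X ω i + b i) ∈ S'}) =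
      (Measure.pi fun _ : Fin n => P).real {w | (∀ k, w k ∈ lowerEvent X (A ∪ B) x) ∧
        (fun i : C => ⨆ k, X (w k) i) ∈ S'} := by
    intro S' hS'
    have hr : Measurable fun (v : I → ℝ) (i : C) => v i :=
      measurable_pi_lambda _ fun i => measurable_pi_apply _
    have := hidr ({v | ∀ i ∈ A ∪ B, v i ≤ x i} ∩ {v | (fun i : C => v i) ∈ S'})
      ((hmD _).inter (hr hS'))
    refine this.trans ?_
    congr 1
    ext w
    exact and_congr_left fun _ => iSup_le_iff_forall_mem_lowerEvent hn X _ x w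
  have hle : ∀ T' ⊆ T, MeasurableSet[MeasurableSpace.comap (subvector X C) inferInstance] T' →
      P.real (GA A ∩ GA B ∩ T') ≤ c * P.real T' := by
    rintro _ hT'T ⟨t, ht, rfl⟩
    -- the affine map is invertible, so an event in `σ(X_C)` is one about `a X_C + b`, and thus
    -- corresponds to one about `M_C`
    let S' : Set (C → ℝ) := S ∩ {v | (fun i : C => (v i - b i) / a i) ∈ t}
    have hS' : MeasurableSet S' := hS.inter ((measurable_pi_lambda _ fun i =>
      ((measurable_pi_apply i).sub_const _).div_const _ : Measurable fun (v : C → ℝ) (i : C) =>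
        (v i - b i) / a i) ht)
    have hTS : subvector X C ⁻¹' t = {ω | (fun i : C => a i * X ω i + b i) ∈ S'} := by
      have : ∀ ω, (fun i : C => (a i * X ω i + b i - b i) / a i) = subvector X C ω :=
        fun ω => funext fun i => by
          rw [add_sub_cancel_right, mul_div_cancel_left₀ _ (ha i).ne']; rfl
      ext ω
      simp only [S', Set.mem_preimage, Set.mem_ofPred_eq, Set.mem_inter_iff, this]
      exact ⟨fun h => ⟨hT'T h, h⟩, fun h => h.2⟩
    rw [hGAU, hTS, hmax S' hS']
    have e2 : P.real {ω | (fun i : C => a i * X ω i + b i) ∈ S'} =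
        (Measure.pi fun _ : Fin n => P).real {w | (fun i : C => ⨆ k, X (w k) i) ∈ S'} :=
      hidr {v | (fun i : C => v i) ∈ S'} ((measurable_pi_lambda _ fun i => measurable_pi_apply _ :
        Measurable fun (v : I → ℝ) (i : C) => v i) hS')
    rw [e2]
    have hPq : P (lowerEvent X (A ∪ B) x) = ENNReal.ofReal q := by
      rw [← hq, ofReal_measureReal]
    have hPp : P ((lowerEvent X (A ∪ B) x)ᶜ ∩ lowerEvent X C y) = ENNReal.ofReal p := by
      rw [← hp, ofReal_measureReal]
    have hs1 : q / (q + p) ≤ 1 := div_le_one_of_le₀ (by linarith) (by linarith)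
    have hex := measure_forall_mem_and_iSup_mem_le (ι := Fin n) P hW
      (measurableSet_lowerEvent hX (A ∪ B) x)
      ((measurableSet_lowerEvent hX (A ∪ B) x).compl.inter (measurableSet_lowerEvent hX C y))
      (disjoint_compl_right.mono_right Set.inter_subset_left)
      (y₀ := fun i : C => y i) (fun ω hω i => hω.2 i i.2) hS'
      (fun v hv i => (hv.1 i).le) (s := ENNReal.ofReal (q / (q + p)))
      (ENNReal.ofReal_le_one.2 hs1) (by
        intro r hr
        rw [hPp]
        rw [hPq] at hr
        lift r to NNReal using ne_top_of_le_ne_top ENNReal.ofReal_ne_top hr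
        have hr' : (r : ℝ) ≤ q := by
          rwa [← ENNReal.ofReal_coe_nnreal, ENNReal.ofReal_le_ofReal_iff hq0.le] at hr
        rw [← ENNReal.ofReal_coe_nnreal, ← ENNReal.ofReal_add r.coe_nonneg hp0,
          ← ENNReal.ofReal_mul (by positivity)]
        refine ENNReal.ofReal_le_ofReal ?_
        rw [div_mul_eq_mul_div, le_div_iff₀ (by linarith)]
        nlinarith)
    have hex' := ENNReal.toReal_mono (by finiteness) hex
    rw [ENNReal.toReal_mul, ENNReal.toReal_mul, ENNReal.toReal_pow, ENNReal.toReal_pow,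
      ENNReal.toReal_ofReal (by positivity), Fintype.card_fin, ENNReal.toReal_natCast,
      ← mul_assoc] at hex'
    exact hex'
  have hpos : ∀ E ⊆ A ∪ B, 0 < P.real (lowerEvent X E x) := fun E hE =>
    (hq ▸ hq0).trans_le (measureReal_mono fun ω hω i hi => hω i (hE hi))
  have hmain := measureReal_inter_inter_le_sqrt hm P (hGAm A) (hGAm B) hT hcond (c := c)
    (by positivity) (pow_pos (hpos A Set.subset_union_left) n)
    (pow_pos (hpos B Set.subset_union_right) n) (hGA A).le (hGA B).le hle
  rw [mul_assoc, ← mul_pow] at hmain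
  refine le_trans ?_ hmain
  rw [hGAU, hmax S hS, sub_le_iff_le_add, ← hq, ← pi_setOf_forall_mem]
  simp only [← pi_setOf_forall_mem]
  refine (measureReal_mono ?_).trans ((measureReal_union_le _ _).trans
    (add_le_add_right (measureReal_iUnion_fintype_le _) _))
  intro w hw
  by_cases h : (fun i : C => ⨆ k, X (w k) i) ∈ S
  · exact Or.inl ⟨hw, h⟩
  · right
    simp only [S, Set.mem_ofPred_eq, not_forall, not_lt] at h
    obtain ⟨i, hi⟩ := h
    exact Set.mem_iUnion.2 ⟨i, fun k =>
      ⟨hw k, (le_ciSup (Set.finite_range _).bddAbove k).trans hi⟩⟩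

/-- Comparison of the exponential rates on both sides of the bound for the `n`-fold maximum. Here
the strict inequality `hlt` makes the event that some conditioning coordinate of the maximum is
below `y` negligible. -/
theorem measureReal_lowerEvent_union_mul_le {P : Measure Ω} [IsProbabilityMeasure P]
    (hX : Measurable X) (hms : IsMaxStable P X) {A B C : Set I}
    (hci : CondIndepGiven P (subvector X A) (subvector X B) (subvector X C))
    {x y : I → ℝ} (hlt : ∀ i ∈ C, P.real (lowerEvent X (A ∪ B) x ∩ {ω | X ω i ≤ y i}) <
      P.real (lowerEvent X (A ∪ B) x)) :
    P.real (lowerEvent X (A ∪ B) x) * P.real (lowerEvent X C y) ≤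
      P.real (lowerEvent X A x) * P.real (lowerEvent X B x) := by
  classical
  obtain hq0 | hq0 := (measureReal_nonneg (μ := P) (s := lowerEvent X (A ∪ B) x)).eq_or_lt
  · rw [← hq0, zero_mul]
    positivity
  have hpos : ∀ E ⊆ A ∪ B, 0 < P.real (lowerEvent X E x) := fun E hE =>
    hq0.trans_le (measureReal_mono fun ω hω i hi => hω i (hE hi))
  set q := P.real (lowerEvent X (A ∪ B) x) with hq
  set p := P.real ((lowerEvent X (A ∪ B) x)ᶜ ∩ lowerEvent X C y) with hp
  have hp0 : 0 ≤ p := measureReal_nonneg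
  have h1 := sq_le_mul_of_forall_pow_sub_sum_le (κ := C) hq0
    (s := q / (q + p)) (by positivity)
    (mul_pos (hpos A Set.subset_union_left) (hpos B Set.subset_union_right))
    (fun i => measureReal_nonneg) (fun i => hlt i i.2) _
    (fun n hn => pow_sub_sum_pow_le_sqrt hX hms hci hq.symm hq0 hp.symm hn)
  rw [div_mul_eq_mul_div, le_div_iff₀ (by positivity)] at h1
  have h2 : q * (q + p) ≤ P.real (lowerEvent X A x) * P.real (lowerEvent X B x) := by
    nlinarith
  have h3 : P.real (lowerEvent X C y) ≤ q + p := by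
    refine (measureReal_mono fun ω hω => ?_).trans (measureReal_union_le _ _)
    by_cases h : ω ∈ lowerEvent X (A ∪ B) x
    exacts [Or.inl h, Or.inr ⟨h, hω⟩]
  exact (mul_le_mul_of_nonneg_left h3 hq0.le).trans h2

end

/-! ### Positive dependence -/

open Filter Topology in
/-- The inequality `w ≥ u + v - 1` for `n`-th roots becomes `γ ≥ α β` in the limit `n → ∞`. -/
theorem mul_le_of_forall_exists_root {α β γ : ℝ} (hα : 0 < α) (hβ : 0 < β)
    (h : ∀ n : ℕ, 1 ≤ n → ∃ u v w : ℝ, 0 ≤ u ∧ u ≤ 1 ∧ 0 ≤ v ∧ v ≤ 1 ∧ u ^ n = α ∧ v ^ n = β ∧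
      w ^ n = γ ∧ u + v - 1 ≤ w) : α * β ≤ γ := by
  set K := Real.log α * Real.log β / (α * β) with hK
  have hlim : Tendsto (fun n : ℕ => α * β * (1 - K / n)) atTop (𝓝 (α * β)) := by
    simpa using ((tendsto_const_div_atTop_nhds_zero_nat K).const_sub 1).const_mul (α * β)
  refine le_of_tendsto hlim ?_
  filter_upwards [eventually_ge_atTop 1, eventually_ge_atTop ⌈K⌉₊] with n hn hnK
  obtain ⟨u, v, w, hu0, hu1, hv0, hv1, hu, hv, hw, huvw⟩ := h n hn
  have hn0 : (1 : ℝ) ≤ n := by exact_mod_cast hn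
  have hKn : K ≤ n := (Nat.le_ceil K).trans (by exact_mod_cast hnK)
  have hK2 : K / (n : ℝ) ^ 2 ≤ 1 := by
    rw [div_le_one (by positivity)]; nlinarith
  have hroot : ∀ {t a : ℝ}, 0 ≤ t → t ≤ 1 → t ^ n = a → 0 < a →
      0 < t ∧ a ≤ t ∧ 1 - t ≤ -Real.log a / n := by
    intro t a h0 h1 h2 h3
    have ht : 0 < t := h0.lt_of_ne fun h => by
      rw [← h, zero_pow (by omega)] at h2; exact h3.ne h2
    refine ⟨ht, h2 ▸ pow_le_of_le_one h0 h1 (by omega), ?_⟩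
    rw [← h2, Real.log_pow, neg_div, mul_div_cancel_left₀ _ (by positivity)]
    linarith [Real.log_le_sub_one_of_pos ht]
  obtain ⟨hu2, hu3, hu4⟩ := hroot hu0 hu1 hu hα
  obtain ⟨hv2, hv3, hv4⟩ := hroot hv0 hv1 hv hβ
  have hαβ : α * β ≤ u * v := mul_le_mul hu3 hv3 hβ.le hu0
  have h1 : (1 - u) * (1 - v) ≤ α * β * (K / (n : ℝ) ^ 2) := by
    calc (1 - u) * (1 - v) ≤ (-Real.log α / n) * (-Real.log β / n) :=
          mul_le_mul hu4 hv4 (by linarith) (by linarith)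
      _ = _ := by rw [hK]; field_simp
  have hK0 : 0 ≤ K / (n : ℝ) ^ 2 := by
    have : 0 ≤ α * β * (K / (n : ℝ) ^ 2) :=
      (mul_nonneg (by linarith) (by linarith)).trans h1
    exact nonneg_of_mul_nonneg_right this (by positivity)
  have h2 : u * v * (1 - K / (n : ℝ) ^ 2) ≤ w := by nlinarith
  calc α * β * (1 - K / n) = α * β * (1 + n * (-(K / (n : ℝ) ^ 2))) := by field_simp; ring
    _ ≤ α * β * (1 + -(K / (n : ℝ) ^ 2)) ^ n := by
        gcongr
        exact one_add_mul_le_pow (by linarith) n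
    _ = (u * v * (1 - K / (n : ℝ) ^ 2)) ^ n := by rw [mul_pow, mul_pow, hu, hv]; ring
    _ ≤ w ^ n := pow_le_pow_left₀ (mul_nonneg (by positivity) (by linarith)) h2 n
    _ = γ := hw

section

variable {I Ω : Type*} [Fintype I] [MeasurableSpace Ω] {X : Ω → I → ℝ} {P : Measure Ω}

/-- The distribution function of a max-stable vector has `n`-th roots of the same type. -/
theorem IsMaxStable.exists_pow_eq [IsProbabilityMeasure P] (hms : IsMaxStable P X)
    (x : I → ℝ) {n : ℕ} (hn : 1 ≤ n) :
    ∃ z : I → ℝ, ∀ E : Set I, P.real (lowerEvent X E z) ^ n = P.real (lowerEvent X E x) := by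
  obtain ⟨a, b, ha, hid⟩ := hms n hn
  refine ⟨fun i => a i * x i + b i, fun E => ?_⟩
  have h := congrArg ENNReal.toReal (hid.measure_mem_eq
    (measurableSet_lowerEvent (X := id) measurable_id E fun i => a i * x i + b i))
  rw [← pi_setOf_forall_mem]
  refine Eq.trans (congrArg _ ?_) (h.symm.trans (congrArg _ ?_))
  · ext w
    exact (iSup_le_iff_forall_mem_lowerEvent hn X E _ w).symm
  · congr 1
    ext ω
    simp [lowerEvent, ha]

/-- Subvectors of a max-stable vector are positively dependent: the inequality
`P (U ∩ V) ≥ P U + P V - 1` holds for all `n`-th roots of the distribution function. -/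
theorem IsMaxStable.mul_le_measureReal_lowerEvent_union [IsProbabilityMeasure P] (hX : Measurable X)
    (hms : IsMaxStable P X) (A B : Set I) (x : I → ℝ) :
    P.real (lowerEvent X A x) * P.real (lowerEvent X B x) ≤ P.real (lowerEvent X (A ∪ B) x) := by
  obtain h0 | hA := (measureReal_nonneg (μ := P) (s := lowerEvent X A x)).eq_or_lt
  · rw [← h0, zero_mul]; exact measureReal_nonneg
  obtain h0 | hB := (measureReal_nonneg (μ := P) (s := lowerEvent X B x)).eq_or_lt
  · rw [← h0, mul_zero]; exact measureReal_nonneg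
  refine mul_le_of_forall_exists_root hA hB fun n hn => ?_
  obtain ⟨z, hz⟩ := hms.exists_pow_eq x hn
  refine ⟨_, _, _, measureReal_nonneg, measureReal_le_one, measureReal_nonneg, measureReal_le_one,
    hz A, hz B, hz (A ∪ B), ?_⟩
  rw [lowerEvent_union]
  have h1 := measureReal_union_add_inter (μ := P) (s := lowerEvent X A z)
    (measurableSet_lowerEvent hX B z)
  have h2 := measureReal_le_one (μ := P) (s := lowerEvent X A z ∪ lowerEvent X B z)
  linarith

/-! ### The support and the conditioning level -/

section Density

variable {J : I → Set ℝ}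

theorem HasPosContDensityOn.ae_mem (hX : Measurable X) (hJ : ∀ i, IsOpen (J i))
    (h : HasPosContDensityOn P X (Set.univ.pi J)) : ∀ᵐ ω ∂P, ∀ i, X ω i ∈ J i := by
  obtain ⟨f, -, -, hlaw⟩ := h
  have hU : MeasurableSet (Set.univ.pi J) :=
    MeasurableSet.univ_pi fun i => (hJ i).measurableSet
  have h1 : ∀ᵐ x ∂(P.map X), x ∈ Set.univ.pi J := by
    rw [hlaw]
    exact (withDensity_absolutelyContinuous _ _).ae_le (ae_restrict_mem hU)
  filter_upwards [ae_of_ae_map hX.aemeasurable h1] with ω hω i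
  exact hω i trivial

theorem HasPosContDensityOn.measure_pos (hX : Measurable X) (hJ : ∀ i, IsOpen (J i))
    (h : HasPosContDensityOn P X (Set.univ.pi J)) {O : I → Set ℝ} (hO : ∀ i, IsOpen (O i))
    (hne : ∀ i, (O i).Nonempty) (hOJ : ∀ i, O i ⊆ J i) : 0 < P {ω | ∀ i, X ω i ∈ O i} := by
  obtain ⟨f, hf, hpos, hlaw⟩ := h
  have hU : MeasurableSet (Set.univ.pi J) :=
    MeasurableSet.univ_pi fun i => (hJ i).measurableSet
  have hOo : IsOpen (Set.univ.pi O) := isOpen_set_pi Set.finite_univ fun i _ => hO i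
  have hsub : Set.univ.pi O ⊆ Set.univ.pi J := Set.pi_mono fun i _ => hOJ i
  have e : P {ω | ∀ i, X ω i ∈ O i} = P.map X (Set.univ.pi O) := by
    rw [Measure.map_apply hX hOo.measurableSet]
    congr 1
    ext ω
    simp
  rw [e, hlaw, pos_iff_ne_zero, Ne, withDensity_apply_eq_zero' (hf.aemeasurable hU).ennreal_ofReal]
  refine ((hOo.measure_pos volume (Set.univ_pi_nonempty_iff.2 hne)).trans_le ?_).ne'
  rw [Measure.restrict_apply']
  · exact measure_mono fun v hv => ⟨⟨(ENNReal.ofReal_pos.2 (hpos v (hsub hv))).ne', hv⟩, hsub hv⟩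
  · exact hU

open Topology in
/-- Positivity of the density makes the distribution function strictly increasing in each
coordinate, here from the level `y i` in the interior of the support to `∞`. -/
theorem HasPosContDensityOn.measureReal_lowerEvent_inter_lt [IsProbabilityMeasure P]
    (hX : Measurable X)
    (hJ : ∀ i, IsOpen (J i)) (h : HasPosContDensityOn P X (Set.univ.pi J)) {E : Set I}
    {x y : I → ℝ} (hy : ∀ i, y i ∈ J i) (hx : 0 < P.real (lowerEvent X E x)) {i : I}
    (hi : i ∉ E) :
    P.real (lowerEvent X E x ∩ {ω | X ω i ≤ y i}) < P.real (lowerEvent X E x) := by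
  classical
  have hm : MeasurableSet {ω | X ω i ≤ y i} :=
    measurableSet_le ((measurable_pi_apply i).comp hX) measurable_const
  have hlow : ∃ ω, ω ∈ lowerEvent X E x ∧ ∀ i, X ω i ∈ J i := by
    by_contra! hcon
    have : P (lowerEvent X E x) = 0 := by
      rw [measure_eq_zero_iff_ae_notMem]
      filter_upwards [h.ae_mem hX hJ] with ω hω hωE
      obtain ⟨i, hi⟩ := hcon ω hωE
      exact hi (hω i)
    simp [measureReal_def, this] at hx
  obtain ⟨ω₀, hω₀, hωJ⟩ := hlow
  -- an open box in the support on which `X_E < x` and `X_j > y j` for all `j ∉ E`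
  have hpos := h.measure_pos hX hJ
    (O := fun j => J j ∩ if j ∈ E then Set.Iio (x j) else Set.Ioi (y j))
    (fun j => (hJ j).inter (by split_ifs; exacts [isOpen_Iio, isOpen_Ioi]))
    (fun j => by
      split_ifs with hj
      · obtain ⟨t, ht, ht'⟩ := Filter.nonempty_of_mem (Filter.inter_mem
          (mem_nhdsWithin_of_mem_nhds ((hJ j).mem_nhds (hωJ j)))
          (self_mem_nhdsWithin (s := Set.Iio (X ω₀ j))))
        exact ⟨t, ht, lt_of_lt_of_le ht' (hω₀ j hj)⟩
      · obtain ⟨t, ht, ht'⟩ := Filter.nonempty_of_mem (Filter.inter_mem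
          (mem_nhdsWithin_of_mem_nhds ((hJ j).mem_nhds (hy j)))
          (self_mem_nhdsWithin (s := Set.Ioi (y j))))
        exact ⟨t, ht, ht'⟩)
    (fun j => Set.inter_subset_left)
  have hpos' : 0 < P.real (lowerEvent X E x \ {ω | X ω i ≤ y i}) := by
    have hsub : {ω | ∀ j, X ω j ∈ J j ∩ if j ∈ E then Set.Iio (x j) else Set.Ioi (y j)} ⊆
        lowerEvent X E x \ {ω | X ω i ≤ y i} := by
      refine fun ω hω => ⟨fun j hj => ?_, ?_⟩
      · have := (hω j).2
        rw [if_pos hj] at this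
        exact le_of_lt this
      · have := (hω i).2
        rw [if_neg hi] at this
        exact not_le.2 (Set.mem_Ioi.1 this)
    exact ENNReal.toReal_pos (hpos.trans_le (measure_mono hsub)).ne' (measure_ne_top _ _)
  have := measureReal_inter_add_sdiff (μ := P) (s := lowerEvent X E x) hm
  linarith

theorem HasPosContDensityOn.exists_mem_measureReal_gt_le [IsProbabilityMeasure P]
    (hX : Measurable X)
    (hJ : ∀ i, IsOpen (J i)) (h : HasPosContDensityOn P X (Set.univ.pi J)) {ε : ℝ} (hε : 0 < ε)
    (i : I) : ∃ t ∈ J i, P.real {ω | t < X ω i} ≤ ε := by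
  have hXi : Measurable fun ω => X ω i := (measurable_pi_apply i).comp hX
  have : IsProbabilityMeasure (P.map fun ω => X ω i) :=
    Measure.isProbabilityMeasure_map hXi.aemeasurable
  have h1 : (P.map fun ω => X ω i) (J i) = 1 := by
    rw [Measure.map_apply hXi (hJ i).measurableSet]
    exact mem_ae_iff_prob_eq_one (hXi (hJ i).measurableSet) |>.1
      ((h.ae_mem hX hJ).mono fun ω hω => hω i)
  have h2 : 1 - ENNReal.ofReal ε < (P.map fun ω => X ω i) (J i) := by
    rw [h1]
    exact ENNReal.sub_lt_self ENNReal.one_ne_top one_ne_zero (ENNReal.ofReal_pos.2 hε).ne'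
  obtain ⟨K, hKJ, hK, hKε⟩ := (hJ i).exists_lt_isCompact h2
  have hne : K.Nonempty := nonempty_of_measure_ne_zero (pos_of_gt hKε).ne'
  obtain ⟨t, htK, ht⟩ := hK.exists_isGreatest hne
  refine ⟨t, hKJ htK, ENNReal.toReal_le_of_le_ofReal hε.le ?_⟩
  have hKm : MeasurableSet ((fun ω => X ω i) ⁻¹' K) := hXi hK.measurableSet
  rw [Measure.map_apply hXi hK.measurableSet] at hKε
  calc P {ω | t < X ω i} ≤ P ((fun ω => X ω i) ⁻¹' K)ᶜ :=
        measure_mono fun ω hω hωK => not_lt.2 (ht hωK) hω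
    _ = 1 - P ((fun ω => X ω i) ⁻¹' K) := prob_compl_eq_one_sub hKm
    _ ≤ ENNReal.ofReal ε := by
        rw [tsub_le_iff_right, add_comm]
        exact tsub_le_iff_right.1 hKε.le

/-- Conditional independence of `X_A` and `X_B` forces the reverse of positive dependence, when
the level in the conditioning coordinates tends to the upper end of the support. -/
theorem measureReal_lowerEvent_union_le_mul [IsProbabilityMeasure P] (hX : Measurable X)
    (hms : IsMaxStable P X)
    (hJ : ∀ i, IsOpen (J i)) (h : HasPosContDensityOn P X (Set.univ.pi J)) {A B : Set I}
    (hci : CondIndepGiven P (subvector X A) (subvector X B) (subvector X (A ∪ B)ᶜ)) (x : I → ℝ) :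
    P.real (lowerEvent X (A ∪ B) x) ≤ P.real (lowerEvent X A x) * P.real (lowerEvent X B x) := by
  obtain hq0 | hq0 := (measureReal_nonneg (μ := P) (s := lowerEvent X (A ∪ B) x)).eq_or_lt
  · rw [← hq0]; positivity
  refine le_of_forall_pos_le_add fun ε hε => ?_
  have hδ : 0 < ε / (Fintype.card I + 1) := by positivity
  choose y hyJ hy using h.exists_mem_measureReal_gt_le hX hJ hδ
  have h1 := measureReal_lowerEvent_union_mul_le (x := x) (y := y) hX hms hci fun i hi =>
    h.measureReal_lowerEvent_inter_lt hX hJ hyJ hq0 hi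
  have h2 : P.real (lowerEvent X (A ∪ B)ᶜ y)ᶜ ≤ ε := by
    calc P.real (lowerEvent X (A ∪ B)ᶜ y)ᶜ ≤ P.real (⋃ i, {ω | y i < X ω i}) := by
          refine measureReal_mono fun ω hω => ?_
          simp only [lowerEvent, Set.mem_compl_iff, Set.mem_ofPred_eq, not_forall, not_le] at hω
          obtain ⟨i, -, hi⟩ := hω
          exact Set.mem_iUnion.2 ⟨i, hi⟩
      _ ≤ ∑ i, P.real {ω | y i < X ω i} := measureReal_iUnion_fintype_le _
      _ ≤ ∑ i : I, ε / (Fintype.card I + 1) := Finset.sum_le_sum fun i _ => hy i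
      _ ≤ ε := by
          rw [Finset.sum_const, Finset.card_univ, nsmul_eq_mul, mul_div_assoc',
            div_le_iff₀ (by positivity)]
          linarith
  rw [probReal_compl_eq_one_sub (measurableSet_lowerEvent hX _ y)] at h2
  have h3 := measureReal_le_one (μ := P) (s := lowerEvent X (A ∪ B) x)
  nlinarith

end Density

end

/-! ### Factorization of distribution functions -/

theorem generateFrom_range_Iic_pi {κ : Type*} [Finite κ] :
    MeasurableSpace.generateFrom (Set.range (Set.Iic : (κ → ℝ) → Set (κ → ℝ))) =
      MeasurableSpace.pi := by
  rw [← generateFrom_eq_pi (C := fun _ : κ => Set.range (Set.Iic : ℝ → Set ℝ))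
    (fun _ => by rw [← borel_eq_generateFrom_Iic, BorelSpace.measurable_eq (α := ℝ)])
    (fun _ => ⟨fun n : ℕ => Set.Iic (n : ℝ), fun n => ⟨_, rfl⟩, by
      ext t; simpa using exists_nat_ge t⟩)]
  congr 1
  ext s
  constructor
  · rintro ⟨x, rfl⟩
    exact ⟨fun i => Set.Iic (x i), fun i _ => ⟨x i, rfl⟩, Set.pi_univ_Iic x⟩
  · rintro ⟨t, ht, rfl⟩
    choose x hx using fun i => ht i trivial
    exact ⟨x, by rw [← Set.pi_univ_Iic]; congr 1; exact funext hx⟩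

theorem isPiSystem_preimage_Iic {Ω κ : Type*} (V : Ω → κ → ℝ) :
    IsPiSystem (Set.preimage V '' Set.range (Set.Iic : (κ → ℝ) → Set (κ → ℝ))) := by
  rintro _ ⟨_, ⟨x, rfl⟩, rfl⟩ _ ⟨_, ⟨y, rfl⟩, rfl⟩ -
  exact ⟨_, ⟨x ⊓ y, rfl⟩, by rw [← Set.Iic_inter_Iic]; rfl⟩

/-- Random vectors are independent if their joint distribution function is the product of their
distribution functions. -/
theorem indepFun_of_measure_le_inter_le {Ω κ ι : Type*} [Finite κ] [Finite ι] [MeasurableSpace Ω]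
    {P : Measure Ω} [IsProbabilityMeasure P] {Y : Ω → κ → ℝ} {Z : Ω → ι → ℝ} (hY : Measurable Y)
    (hZ : Measurable Z)
    (h : ∀ y z, P ({ω | Y ω ≤ y} ∩ {ω | Z ω ≤ z}) = P {ω | Y ω ≤ y} * P {ω | Z ω ≤ z}) :
    IndepFun Y Z P := by
  rw [IndepFun_iff_Indep]
  refine IndepSets.indep hY.comap_le hZ.comap_le (isPiSystem_preimage_Iic Y)
    (isPiSystem_preimage_Iic Z)
    (by rw [← generateFrom_range_Iic_pi, MeasurableSpace.comap_generateFrom])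
    (by rw [← generateFrom_range_Iic_pi, MeasurableSpace.comap_generateFrom]) ?_
  rw [IndepSets_iff]
  rintro _ _ ⟨_, ⟨y, rfl⟩, rfl⟩ ⟨_, ⟨z, rfl⟩, rfl⟩
  exact h y z

/-- Conditional independence of subvectors implies their independence, for a max-stable vector with
a positive continuous density on a product of open sets. -/
theorem indepFun_subvector {I Ω : Type*} [Fintype I] [MeasurableSpace Ω] {P : Measure Ω}
    [IsProbabilityMeasure P] {X : Ω → I → ℝ} (hX : Measurable X) (hms : IsMaxStable P X)
    {J : I → Set ℝ} (hJ : ∀ i, IsOpen (J i)) (h : HasPosContDensityOn P X (Set.univ.pi J))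
    {A B : Set I} (hAB : Disjoint A B)
    (hci : CondIndepGiven P (subvector X A) (subvector X B) (subvector X (A ∪ B)ᶜ)) :
    IndepFun (subvector X A) (subvector X B) P := by
  classical
  have hsub : ∀ E : Set I, Measurable (subvector X E) := fun E =>
    measurable_pi_lambda _ fun i => (measurable_pi_apply _).comp hX
  refine indepFun_of_measure_le_inter_le (hsub A) (hsub B) fun y z => ?_
  let x : I → ℝ := fun i =>
    if hA : i ∈ A then y ⟨i, hA⟩ else if hB : i ∈ B then z ⟨i, hB⟩ else 0
  have eA : {ω | subvector X A ω ≤ y} = lowerEvent X A x := by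
    ext ω
    simp only [lowerEvent, Pi.le_def, subvector, Set.mem_ofPred_eq, Subtype.forall]
    exact forall₂_congr fun i hi => by simp [x, hi]
  have eB : {ω | subvector X B ω ≤ z} = lowerEvent X B x := by
    ext ω
    simp only [lowerEvent, Pi.le_def, subvector, Set.mem_ofPred_eq, Subtype.forall]
    exact forall₂_congr fun i hi => by simp [x, hi, hAB.notMem_of_mem_right hi]
  have key : P.real (lowerEvent X (A ∪ B) x) =
      P.real (lowerEvent X A x) * P.real (lowerEvent X B x) :=
    le_antisymm (measureReal_lowerEvent_union_le_mul hX hms hJ h hci x)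
      (hms.mul_le_measureReal_lowerEvent_union hX A B x)
  rw [eA, eB, ← lowerEvent_union]
  simpa [measureReal_def, ← ENNReal.toReal_mul, ENNReal.toReal_eq_toReal_iff',
    ENNReal.mul_ne_top] using key

end MaxStable

theorem theorem1 {I Ω : Type*} [Fintype I] [MeasurableSpace Ω]
    (P : Measure Ω) [IsProbabilityMeasure P] (X : Ω → I → ℝ) (hX : Measurable X) :
    -- simple max-stable vectors, with a positive continuous density on the open orthant
    (MaxStable.IsSimpleMaxStable P X →
      MaxStable.HasPosContDensityOn P X (Set.univ.pi fun _ : I => Set.Ioi (0 : ℝ)) →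
      ∀ A B : Set I, A.Nonempty → B.Nonempty → Disjoint A B →
        MaxStable.CondIndepGiven P (MaxStable.subvector X A) (MaxStable.subvector X B)
          (MaxStable.subvector X (A ∪ B)ᶜ) →
        IndepFun (MaxStable.subvector X A) (MaxStable.subvector X B) P) ∧
    -- general max-stable vectors, with a positive continuous density on a product of open intervals
    (MaxStable.IsMaxStable P X →
      (∃ J : I → Set ℝ, (∀ i, IsOpen (J i) ∧ (J i).OrdConnected) ∧
        MaxStable.HasPosContDensityOn P X (Set.univ.pi J)) →
      ∀ A B : Set I, A.Nonempty → B.Nonempty → Disjoint A B →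
        MaxStable.CondIndepGiven P (MaxStable.subvector X A) (MaxStable.subvector X B)
          (MaxStable.subvector X (A ∪ B)ᶜ) →
        IndepFun (MaxStable.subvector X A) (MaxStable.subvector X B) P) := by
  refine ⟨fun hms h A B _ _ hAB hci =>
    MaxStable.indepFun_subvector hX hms.1 (fun _ => isOpen_Ioi) h hAB hci, ?_⟩
  rintro hms ⟨J, hJ, h⟩ A B - - hAB hci
  exact MaxStable.indepFun_subvector hX hms (fun i => (hJ i).1) h hAB hci
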